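/- Let $L\ge 2$, $k\ge 2$, $\beta\ge 2$ be integers, let $a_0,\dots,a_{L-1}$ be $L$ distinct complex numbers (indices taken mod $L$), and let $\kappa:\{1,\dots,k-1\}\times\mathbb{N}\to\{0,\dots,L-1\}$ be a map, where $\mathbb N=\{0,1,2,\dots\}$. Let $f$ be the map on finite words in these letters that replaces each letter $a_i$ by $a_{i+1}$, put $A_0=a_0$ and $$A_{n+1}=A_n\,f^{\kappa(1,n)}(A_n)\,f^{\kappa(2,n)}(A_n)\cdots f^{\kappa(k-1,n)}(A_n)\qquad(n\ge 0),$$ and let $(a(n))_{n\ge 0}$ be the limit of the words $A_n$, i.e. the sequence whose prefix of length $k^m$ is $A_m$ for every $m\ge 0$ (the $(L,k,\kappa)$-TM sequence). Assume that * $a(n)\in\{0,1,\dots,\beta-1\}$ for all $n\ge 0$; * the sequence is $n$-period: there are integers $N_0\ge 0$ and $t>0$ such that $\kappa(s,n)=\kappa(s,n+t)$ for all $1\le s\le k-1$ and all $n\ge N_0$; * there is no integer $A\ge 0$ such that $\kappa(s,A+y)\equiv\kappa(1,A)\,s\,k^y \pmod L$ for all $1\le s\le k-1$ and all $y\in\mathbb{N}$.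 Then for all integers $N\ge 0$ and $l>0$ the number $$\alpha=\sum_{n=0}^\infty\frac{a(N+nl)}{\beta^{n+1}}$$ is irrational and its irrationality exponent $\mu(\alpha)$ is finite. Here $\mu(\alpha)$ is the supremum of the real numbers $\mu$ such that $\left|\alpha-\frac pq\right|<\frac1{|q|^{\mu}}$ has infinitely many solutions in non-zero integers $p$ and $q$. -/

import Mathlib

namespace GenThueMorse

/-- The cyclic morphism `a_i ↦ a_{i+1}` (indices mod `L`), acting on the indices of the letters. -/
def shift (L : ℕ) (i : ZMod L) : ZMod L := i + 1

/-- The words `A_n`, written through the indices (in `ZMod L`) of their letters: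
`A_0 = a_0` and `A_{n+1} = A_n f^{κ(1,n)}(A_n) ⋯ f^{κ(k-1,n)}(A_n)`, where `f` is the cyclic
morphism.  Only the values `κ s y` with `1 ≤ s ≤ k - 1` are used. -/
def word (L k : ℕ) (κ : ℕ → ℕ → Fin L) : ℕ → List (ZMod L)
  | 0 => [0]
  | n + 1 => word L k κ n ++
      (List.range' 1 (k - 1)).flatMap fun s => (word L k κ n).map ((shift L)^[(κ s n : ℕ)])

/-- The generalized Thue-Morse sequence of type `(L, k, κ)` over the letters `c 0, …, c (L-1)`:
the limit of the words `A_n`.  As `A_m` has length `k ^ m` and is a prefix of `A_{m+1}`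
the term of index `n` can be read off in `A_n` (for `k ≥ 2`); see `map_seq_range`. -/
def seq (L k : ℕ) (κ : ℕ → ℕ → Fin L) (c : ZMod L → ℂ) (n : ℕ) : ℂ :=
  c ((word L k κ n).getD n 0)

theorem length_word (L k : ℕ) (hk : 2 ≤ k) (κ : ℕ → ℕ → Fin L) (m : ℕ) :
    (word L k κ m).length = k ^ m := by
  induction m with
  | zero => simp [word]
  | succ m ih =>
    obtain ⟨j, rfl⟩ : ∃ j, k = j + 1 := ⟨k - 1, by omega⟩
    simp [word, List.length_flatMap, ih]
    ring

theorem word_prefix (L k : ℕ) (κ : ℕ → ℕ → Fin L) {m n : ℕ} (h : m ≤ n) :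
    word L k κ m <+: word L k κ n := by
  induction n, h using Nat.le_induction with
  | base => exact List.prefix_refl _
  | succ n _ ih => exact ih.trans (List.prefix_append _ _)

/-- The sequence is the limit of the words: its prefix of length `k ^ m` is `A_m`. -/
theorem map_seq_range (L k : ℕ) (hk : 2 ≤ k) (κ : ℕ → ℕ → Fin L) (c : ZMod L → ℂ) (m : ℕ) :
    (List.range (k ^ m)).map (seq L k κ c) = (word L k κ m).map c := by
  apply List.ext_getElem
  · simp [length_word L k hk]
  · intro i h1 h2
    have hm : i < (word L k κ m).length := by simpa using h2
    have hi : i < (word L k κ i).length := by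
      rw [length_word L k hk]; exact Nat.lt_pow_self (by omega)
    simp only [List.getElem_map, List.getElem_range, seq, List.getD_eq_getElem _ _ hi]
    congr 1
    rcases le_total i m with h | h
    · exact (word_prefix L k κ h).getElem hi
    · exact ((word_prefix L k κ h).getElem hm).symm

/-- `κ` is ultimately periodic in its second variable, uniformly in `1 ≤ s ≤ k - 1`; the
sequence of type `(L, k, κ)` is then called `n`-period. -/
def IsNPeriod (L k : ℕ) (κ : ℕ → ℕ → Fin L) : Prop :=
  ∃ N t : ℕ, 0 < t ∧ ∀ s, 1 ≤ s → s ≤ k - 1 → ∀ n, N ≤ n → κ s n = κ s (n + t)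

/-- There is `A` with `κ(s, A + y) ≡ κ(1, A) s k^y (mod L)` for all `1 ≤ s ≤ k - 1`, `y ≥ 0`. -/
def PeriodicityCondition (L k : ℕ) (κ : ℕ → ℕ → Fin L) : Prop :=
  ∃ A : ℕ, ∀ s, 1 ≤ s → s ≤ k - 1 → ∀ y : ℕ,
    (κ s (A + y) : ℕ) ≡ (κ 1 A : ℕ) * s * k ^ y [MOD L]

/-- The irrationality exponent of an (irrational) real number `α`: the supremum, in the extended
reals, of the real `μ` such that `|α - p / q| < 1 / |q| ^ μ` has infinitely many solutions in
non-zero integers `p`, `q`. -/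
noncomputable def irrationalityExponent (α : ℝ) : EReal :=
  sSup ((fun μ : ℝ => (μ : EReal)) '' {μ : ℝ |
    {x : ℤ × ℤ | x.1 ≠ 0 ∧ x.2 ≠ 0 ∧
      |α - (x.1 : ℝ) / (x.2 : ℝ)| < 1 / |(x.2 : ℝ)| ^ μ}.Infinite})

end GenThueMorse

/-!
The index of the `m`-th letter is `∑ κ(m_y, y)` modulo `L`, over the base-`k` digits `m_y ≠ 0` of
`m` (`seq_eq_digitSum`).  Hence for `r < k ^ n` the index at `r + k ^ n * m` is the one at `r` plus
`e_n(m)` (`tailIndex`), where `e_n` is the digit sum with the weights moved down by `n` places; as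
`κ` is ultimately periodic in its second variable, only finitely many functions `e_n` occur.

If some `e_n` is constant along an arithmetic progression, a further shift of it vanishes on the
multiples of some `q` prime to `k`.  Filling in high digits shows that it depends on its argument
modulo `q` only, and moving one summand up by a power of `k` that is `1` modulo `q` shows that it
is additive.  This is the excluded periodicity condition (`periodicityCondition_of_const`), so no
`e_n` is ultimately periodic along the multiples of `l`, and there is a bound, uniform in `n`, for
the place where a given period fails (`exists_uniform_aperiodicity`).

The digits of `α` in a block of length `k ^ n` depend on `l + 1` consecutive values of `e_n`, so
two of the first `L ^ (l + 1) + 1` blocks agree (`exists_equal_blocks`).  This yields a multiplier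
`Q`, at most a fixed power of `β ^ k ^ n`, such that `Q * α` is within `β ^ (-k ^ n)` of an integer.
Conversely, an integer within `β ^ (-C * k ^ n)` of `Q * α` makes a long range of digits periodic
or constant (`periodic_or_const_of_near_int`), which the uniform aperiodicity rules out for a large
constant `C`.  Given `p / q`, take the first `n` with `β ^ k ^ n > 2 * q`.  If `p / q` differs from
the approximation `P / Q`, the triangle inequality keeps it away from `α`; if it equals `P / Q`, the
lower bound for `|Q * α - P|` does (`exists_inv_pow_le_abs_sub`).  So `|α - p / q| ≥ q ^ (-M)` for
all large `q`, which gives the irrationality of `α` along with the bound for its exponent.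
-/

namespace GenThueMorse

/-! ### Digit sums with weights -/

/-- The sum over `y` of the weights `w s y`, where `s` is the digit of `k ^ y` in the base-`k`
expansion of `m`.  The range `y < m` contains all non-zero digits, as `m < k ^ m`; the zero digits
do not count as soon as `w 0 = 0`. -/
def digitSum {M : Type*} [AddCommMonoid M] (k : ℕ) (w : ℕ → ℕ → M) (m : ℕ) : M :=
  ∑ y ∈ Finset.range m, w (m / k ^ y % k) y

section DigitSum

variable {M : Type*} {k : ℕ}

theorem digitSum_eq_sum_range [AddCommMonoid M] (hk : 2 ≤ k) {w : ℕ → ℕ → M}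
    (hw : ∀ y, w 0 y = 0) {m n : ℕ} (h : m < k ^ n) :
    digitSum k w m = ∑ y ∈ Finset.range n, w (m / k ^ y % k) y := by
  have key : ∀ n', m < k ^ n' → ∀ n'', n' ≤ n'' →
      ∑ y ∈ Finset.range n', w (m / k ^ y % k) y = ∑ y ∈ Finset.range n'', w (m / k ^ y % k) y := by
    intro n' h' n'' hle
    refine Finset.sum_subset (Finset.range_mono hle) fun y _ hy => ?_
    have hy' : n' ≤ y := by simpa using hy
    rw [Nat.div_eq_of_lt (h'.trans_le (Nat.pow_le_pow_right (by omega) hy')), Nat.zero_mod, hw]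
  have hm : m < k ^ m := Nat.lt_pow_self (by omega)
  rcases le_total m n with hle | hle
  · exact key m hm n hle
  · exact (key n h m hle).symm

theorem digitSum_add [AddCommMonoid M] (hk : 2 ≤ k) {w : ℕ → ℕ → M} (hw : ∀ y, w 0 y = 0)
    {n r : ℕ} (hr : r < k ^ n) (m : ℕ) :
    digitSum k w (r + k ^ n * m) = digitSum k w r + digitSum k (fun s y => w s (n + y)) m := by
  have hm : m < k ^ m := Nat.lt_pow_self (by omega)
  have hlt : r + k ^ n * m < k ^ (n + m) := by
    rw [pow_add]
    calc r + k ^ n * m < k ^ n * (m + 1) := by rw [mul_add, mul_one]; omega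
      _ ≤ k ^ n * k ^ m := Nat.mul_le_mul_left _ hm
  rw [digitSum_eq_sum_range hk hw hlt, digitSum_eq_sum_range hk hw hr, Finset.sum_range_add]
  refine congrArg₂ _ (Finset.sum_congr rfl fun y hy => ?_) (Finset.sum_congr rfl fun y _ => ?_)
  · obtain ⟨z, rfl⟩ : ∃ z, n = y + 1 + z := ⟨n - (y + 1), by simp at hy; omega⟩
    congr 1
    rw [show r + k ^ (y + 1 + z) * m = r + k ^ y * (k * (k ^ z * m)) by ring,
      Nat.add_mul_div_left _ _ (by positivity), Nat.add_mul_mod_self_left]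
  · congr 2
    rw [pow_add, ← Nat.div_div_eq_div_mul, Nat.add_mul_div_left _ _ (by positivity),
      Nat.div_eq_of_lt hr, zero_add]

theorem digitSum_zero [AddCommMonoid M] (w : ℕ → ℕ → M) : digitSum k w 0 = 0 := by
  simp [digitSum]

theorem digitSum_of_lt [AddCommMonoid M] (hk : 2 ≤ k) {w : ℕ → ℕ → M} (hw : ∀ y, w 0 y = 0)
    {s : ℕ} (hs : s < k) : digitSum k w s = w s 0 := by
  rw [digitSum_eq_sum_range hk hw (n := 1) (by simpa using hs)]
  simp [Nat.mod_eq_of_lt hs]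

theorem digitSum_congr [AddCommMonoid M] (hk : 2 ≤ k) {w w' : ℕ → ℕ → M}
    (h : ∀ s < k, ∀ y, w s y = w' s y) (m : ℕ) : digitSum k w m = digitSum k w' m :=
  Finset.sum_congr rfl fun _ _ => h _ (Nat.mod_lt _ (by omega)) _

/-! ### Digit sums that are constant along an arithmetic progression -/

theorem exists_coprime_dvd_pow_mul (k : ℕ) {l : ℕ} (hl : 0 < l) :
    ∃ A q, 0 < q ∧ q.Coprime k ∧ l ∣ k ^ A * q := by
  induction l using Nat.strong_induction_on with
  | _ l ih =>
    by_cases h : l.Coprime k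
    · exact ⟨0, l, hl, h, by simp⟩
    · obtain ⟨l', hl'⟩ := Nat.gcd_dvd_left l k
      have hg : 0 < l.gcd k := Nat.gcd_pos_of_pos_left _ hl
      have hg1 : l.gcd k ≠ 1 := h
      have hl'0 : 0 < l' := Nat.pos_of_ne_zero fun h0 => by simp [h0] at hl'; omega
      have hlt : l' < l := by
        calc l' < l.gcd k * l' := by nlinarith [show 2 ≤ l.gcd k by omega]
          _ = l := hl'.symm
      obtain ⟨A, q, hq, hqk, hd⟩ := ih l' hlt hl'0
      refine ⟨A + 1, q, hq, hqk, ?_⟩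
      rw [hl', pow_succ', mul_assoc]
      exact Nat.mul_dvd_mul (Nat.gcd_dvd_right l k) hd

/-- A digit sum vanishing on all multiples of some `q` prime to `k` is additive: completing `m` by
high digits to a multiple of `q` shows that its value depends on `m` modulo `q` only, and `m + m'`
can be replaced by `m + k ^ y * m'` with `k ^ y ≡ 1` modulo `q`, where no digits overlap. -/
theorem digitSum_eq_nsmul_of_vanishing [AddCommGroup M] (hk : 2 ≤ k) {w : ℕ → ℕ → M}
    (hw : ∀ y, w 0 y = 0) {q : ℕ} (hq : 0 < q) (hqk : q.Coprime k)
    (h0 : ∀ n, digitSum k w (n * q) = 0) (m : ℕ) :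
    digitSum k w m = m • digitSum k w 1 := by
  have hpow : ∀ B, ∃ y, B < k ^ y ∧ k ^ y ≡ 1 [MOD q] := fun B => by
    have hB : B < k ^ (q.totient * B) :=
      (Nat.lt_pow_self (n := B) (by omega : 1 < k)).trans_le (Nat.pow_le_pow_right (by omega)
        (Nat.le_mul_of_pos_left _ (Nat.totient_pos.2 hq)))
    refine ⟨q.totient * B, hB, ?_⟩
    rw [pow_mul]
    simpa using (Nat.ModEq.pow_totient hqk.symm).pow B
  have hmod : ∀ m₁ m₂, m₁ ≡ m₂ [MOD q] → digitSum k w m₁ = digitSum k w m₂ := by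
    intro m₁ m₂ h
    obtain ⟨y, hy, hy1⟩ := hpow (m₁ + m₂)
    have hz : ∀ m', m' ≡ m₁ [MOD q] → m' < k ^ y →
        digitSum k w m' + digitSum k (fun s z => w s (y + z)) ((q - 1) * m₁) = 0 := by
      intro m' hm' hlt
      rw [← digitSum_add hk hw hlt]
      have : m' + k ^ y * ((q - 1) * m₁) ≡ 0 [MOD q] := by
        calc m' + k ^ y * ((q - 1) * m₁) ≡ m₁ + 1 * ((q - 1) * m₁) [MOD q] :=
              hm'.add (hy1.mul_right _)
          _ = q * m₁ := by
              obtain ⟨q', rfl⟩ : ∃ q', q = q' + 1 := ⟨q - 1, by omega⟩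
              simp; ring
          _ ≡ 0 [MOD q] := Nat.modEq_zero_iff_dvd.2 (dvd_mul_right _ _)
      obtain ⟨n, hn⟩ := Nat.modEq_zero_iff_dvd.1 this
      rw [hn, mul_comm, h0]
    exact add_right_cancel ((hz m₁ rfl (by omega)).trans (hz m₂ h.symm (by omega)).symm)
  have hadd : ∀ m m', digitSum k w (m + m') = digitSum k w m + digitSum k w m' := by
    intro m m'
    obtain ⟨y, hy, hy1⟩ := hpow m
    have h1 : k ^ y * m' ≡ m' [MOD q] := by simpa using hy1.mul_right m'
    have h2 : digitSum k (fun s z => w s (y + z)) m' = digitSum k w m' := by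
      have := digitSum_add hk hw (show 0 < k ^ y by positivity) m'
      rw [digitSum_zero, zero_add, zero_add] at this
      rw [← this, hmod _ _ h1]
    rw [← hmod _ _ (h1.add_left m), digitSum_add hk hw hy, h2]
  induction m with
  | zero => simp [digitSum_zero]
  | succ m ih => rw [hadd, ih, succ_nsmul]

theorem exists_digitSum_eq_nsmul [AddCommGroup M] (hk : 2 ≤ k) {w : ℕ → ℕ → M}
    (hw : ∀ y, w 0 y = 0) {N l : ℕ} (hl : 0 < l)
    (hconst : ∀ n, digitSum k w (N + n * l) = digitSum k w N) :
    ∃ A, ∀ m, digitSum k (fun s y => w s (A + y)) m =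
      m • digitSum k (fun s y => w s (A + y)) 1 := by
  obtain ⟨A, q, hq, hqk, hd⟩ := exists_coprime_dvd_pow_mul k hl
  -- the exponent is enlarged to leave room for `N` below `k ^ (A + N)`
  refine ⟨A + N, digitSum_eq_nsmul_of_vanishing hk (fun y => hw _) hq hqk fun n => ?_⟩
  have hN : N < k ^ (A + N) :=
    (Nat.lt_pow_self (by omega : 1 < k)).trans_le (Nat.pow_le_pow_right (by omega) (by omega))
  obtain ⟨c, hc⟩ := hd
  have h := digitSum_add hk hw hN (n * q)
  rw [show k ^ (A + N) * (n * q) = (k ^ N * n * c) * l by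
    rw [pow_add]; linear_combination (k ^ N * n) * hc, hconst] at h
  simpa using h

end DigitSum

/-! ### The sequence as a digit sum -/

/-- The weights for which the digit sum gives the index of the letters of the sequence: `κ s y`
for a digit `s ≠ 0`, and `0` for the digit `0`. -/
def weight (L : ℕ) (κ : ℕ → ℕ → Fin L) (s y : ℕ) : ZMod L :=
  if s = 0 then 0 else ((κ s y : ℕ) : ZMod L)

theorem weight_zero (L : ℕ) (κ : ℕ → ℕ → Fin L) (y : ℕ) : weight L κ 0 y = 0 := if_pos rfl

theorem shift_iterate (L n : ℕ) (i : ZMod L) : (shift L)^[n] i = i + n := by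
  induction n with
  | zero => simp
  | succ n ih => rw [Function.iterate_succ_apply', ih]; simp [shift, add_assoc]

theorem word_succ {L k : ℕ} (hk : 2 ≤ k) (κ : ℕ → ℕ → Fin L) (n : ℕ) :
    word L k κ (n + 1) =
      (List.range k).flatMap fun s => (word L k κ n).map (· + weight L κ s n) := by
  obtain ⟨j, rfl⟩ : ∃ j, k = j + 1 := ⟨k - 1, by omega⟩
  rw [List.range_succ_eq_map, List.flatMap_cons, List.flatMap_map, word, List.range'_eq_map_range,
    List.flatMap_map]
  congr 1
  · simp [weight]
  · simp only [Nat.add_sub_cancel]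
    congr 1
    funext s
    congr 1
    funext i
    rw [shift_iterate, weight, if_neg (by omega), Nat.add_comm 1 s]

theorem getElem?_flatMap_range {α : Type*} (g : ℕ → List α) {K : ℕ} (hg : ∀ s, (g s).length = K)
    {j s r : ℕ} (hs : s < j) (hr : r < K) :
    ((List.range j).flatMap g)[s * K + r]? = (g s)[r]? := by
  induction j with
  | zero => omega
  | succ j ih =>
    have hlen : ((List.range j).flatMap g).length = j * K := by simp [List.length_flatMap, hg]
    rw [List.range_succ, List.flatMap_append]
    rcases Nat.lt_succ_iff_lt_or_eq.1 hs with h | rfl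
    · rw [List.getElem?_append_left, ih h]
      rw [hlen]
      calc s * K + r < (s + 1) * K := by rw [add_mul, one_mul]; omega
        _ ≤ j * K := Nat.mul_le_mul_right _ h
    · rw [List.getElem?_append_right (by omega), hlen, Nat.add_sub_cancel_left]
      simp

theorem word_getElem? {L k : ℕ} (hk : 2 ≤ k) (κ : ℕ → ℕ → Fin L) {n m : ℕ} (hm : m < k ^ n) :
    (word L k κ n)[m]? = some (digitSum k (weight L κ) m) := by
  induction n generalizing m with
  | zero => simp at hm; simp [hm, word, digitSum_zero]
  | succ n ih =>
    have hr : m % k ^ n < k ^ n := Nat.mod_lt _ (by positivity)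
    have hs : m / k ^ n < k := Nat.div_lt_of_lt_mul (by rwa [← pow_succ])
    have hdm : m / k ^ n * k ^ n + m % k ^ n = m := Nat.div_add_mod' _ _
    have h := getElem?_flatMap_range (fun s => (word L k κ n).map (· + weight L κ s n))
      (K := k ^ n) (fun s => by simp [length_word L k hk]) hs hr
    rw [hdm] at h
    rw [word_succ hk, h, List.getElem?_map, ih hr, Option.map_some]
    congr 1
    conv_rhs => rw [← Nat.mod_add_div m (k ^ n)]
    rw [digitSum_add hk (weight_zero L κ) hr,
      digitSum_of_lt hk (w := fun s y => weight L κ s (n + y)) (fun y => weight_zero L κ _) hs]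
    rfl

theorem seq_eq_digitSum {L k : ℕ} (hk : 2 ≤ k) (κ : ℕ → ℕ → Fin L) (c : ZMod L → ℂ) (m : ℕ) :
    seq L k κ c m = c (digitSum k (weight L κ) m) := by
  rw [seq, List.getD_eq_getElem?_getD,
    word_getElem? hk κ (Nat.lt_pow_self (by omega : 1 < k)), Option.getD_some]

/-- The digit sum of the sequence with the weights moved down by `n` places: the index of the
letter at `r + k ^ n * m` is the one at `r` plus `tailIndex L k κ n m`, for `r < k ^ n`. -/
def tailIndex (L k : ℕ) (κ : ℕ → ℕ → Fin L) (n m : ℕ) : ZMod L :=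
  digitSum k (fun s y => weight L κ s (n + y)) m

theorem seq_add_pow_mul {L k : ℕ} (hk : 2 ≤ k) (κ : ℕ → ℕ → Fin L) (c : ZMod L → ℂ) {n r : ℕ}
    (hr : r < k ^ n) (m : ℕ) :
    seq L k κ c (r + k ^ n * m) = c (digitSum k (weight L κ) r + tailIndex L k κ n m) := by
  rw [seq_eq_digitSum hk, digitSum_add hk (weight_zero L κ) hr, tailIndex]

/-- If `tailIndex` is constant along an arithmetic progression, it is linear after a further
shift, which is the periodicity condition. -/
theorem periodicityCondition_of_const {L k : ℕ} (hk : 2 ≤ k) (κ : ℕ → ℕ → Fin L) (n : ℕ)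
    {N l : ℕ} (hl : 0 < l)
    (hconst : ∀ i, tailIndex L k κ n (N + i * l) = tailIndex L k κ n N) :
    PeriodicityCondition L k κ := by
  have hw : ∀ B : ℕ → ℕ, ∀ y, (fun s y => weight L κ s (B y)) 0 y = 0 :=
    fun B y => weight_zero L κ _
  obtain ⟨A, hA⟩ := exists_digitSum_eq_nsmul hk (w := fun s y => weight L κ s (n + y))
    (hw fun y => n + y) hl hconst
  have hdig : ∀ s, 1 ≤ s → s ≤ k - 1 → ∀ y,
      digitSum k (fun s y => weight L κ s (n + (A + y))) (k ^ y * s) =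
        ((κ s (n + A + y) : ℕ) : ZMod L) := by
    intro s hs hsk y
    have h := digitSum_add hk (w := fun s y => weight L κ s (n + (A + y)))
      (hw fun y => n + (A + y)) (show 0 < k ^ y by positivity) s
    rw [zero_add, digitSum_zero, zero_add] at h
    rw [h, digitSum_of_lt hk (w := fun s z => weight L κ s (n + (A + (y + z))))
      (hw fun z => n + (A + (y + z))) (by omega), weight, if_neg (by omega)]
    simp [add_assoc]
  refine ⟨n + A, fun s hs hsk y => (ZMod.natCast_eq_natCast_iff _ _ _).1 ?_⟩
  have h1 := hdig 1 le_rfl (by omega) 0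
  simp only [pow_zero, one_mul, add_zero] at h1
  have h2 := hA (k ^ y * s)
  rw [hdig s hs hsk y, h1] at h2
  rw [h2]
  simp
  ring


/-! ### Expansions that almost agree with a shift of themselves -/

/-- The integer whose base-`β` digits are `b 0, …, b (T - 1)`, that is, the integer part that
splits off when the number with the expansion `b` is multiplied by `β ^ T`. -/
def digitsPrefix {β : ℕ} (b : ℕ → Fin β) : ℕ → ℤ
  | 0 => 0
  | T + 1 => β * digitsPrefix b T + (b T : ℕ)

theorem pow_mul_ofDigits {β : ℕ} (hβ : 2 ≤ β) (b : ℕ → Fin β) (T : ℕ) :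
    (β : ℝ) ^ T * Real.ofDigits b = digitsPrefix b T + Real.ofDigits fun i => b (i + T) := by
  have hβ0 : (β : ℝ) ≠ 0 := by positivity
  induction T with
  | zero => simp [digitsPrefix]
  | succ T ih =>
    have h := Real.ofDigits_eq_sum_add_ofDigits (fun i => b (i + T)) 1
    have h1 : (fun i => b (i + 1 + T)) = fun i => b (i + (T + 1)) := by
      funext i; congr 1; omega
    simp only [Finset.sum_range_one, Real.ofDigitsTerm, zero_add, pow_one, h1] at h
    rw [pow_succ', mul_assoc, ih, h, digitsPrefix]
    push_cast
    field_simp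
    ring

theorem exists_abs_mul_ofDigits_sub_le {β : ℕ} (hβ : 2 ≤ β) (b : ℕ → Fin β) {u s R : ℕ}
    (h : ∀ i < R, b (u + i) = b (u + s + i)) :
    ∃ P : ℤ, |(β : ℝ) ^ u * ((β : ℝ) ^ s - 1) * Real.ofDigits b - P| ≤ ((β : ℝ) ^ R)⁻¹ := by
  refine ⟨digitsPrefix b (u + s) - digitsPrefix b u, ?_⟩
  have h1 := pow_mul_ofDigits hβ b u
  have h2 := pow_mul_ofDigits hβ b (u + s)
  have h3 : (β : ℝ) ^ u * ((β : ℝ) ^ s - 1) * Real.ofDigits b -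
      ((digitsPrefix b (u + s) - digitsPrefix b u : ℤ) : ℝ) =
      Real.ofDigits (fun i => b (i + (u + s))) - Real.ofDigits fun i => b (i + u) := by
    rw [pow_add] at h2
    push_cast
    linear_combination h2 - h1
  rw [h3]
  refine Real.abs_ofDigits_sub_ofDigits_le fun i hi => ?_
  rw [Nat.add_comm i, Nat.add_comm i, h i hi]

/-- The dichotomy behind carries: if `D` is the sequence of carries in the subtraction of `b` from
its shift by `s`, then a carry that is not zero stays the same from then on, and it forces the
digits of `b` to be all `0` or all `β - 1`. -/
theorem periodic_or_const_of_carry {β : ℤ} {b D : ℕ → ℤ} {s T₁ Tm : ℕ} (hb0 : ∀ T, 0 ≤ b T)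
    (hb : ∀ T, b T < β) (hD : ∀ T, D (T + 1) = β * D T - (b (T + s) - b T))
    (hle : ∀ T ≤ T₁, |D T| ≤ 1) (hm : Tm ≤ T₁) :
    (∀ T < Tm, b (T + s) = b T) ∨ ∀ T, Tm ≤ T → T < T₁ → b T = b Tm := by
  have hstep1 : ∀ T < T₁, D T = 1 → D (T + 1) = 1 ∧ b T = 0 := by
    intro T hT h
    have h1 := abs_le.1 (hle (T + 1) hT)
    have h2 := hD T
    have h3 := hb0 T
    have h4 := hb (T + s)
    rw [h, mul_one] at h2
    omega
  have hstep2 : ∀ T < T₁, D T = -1 → D (T + 1) = -1 ∧ b T = β - 1 := by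
    intro T hT h
    have h1 := abs_le.1 (hle (T + 1) hT)
    have h2 := hD T
    have h3 := hb0 (T + s)
    have h4 := hb T
    rw [h, mul_neg_one] at h2
    omega
  have hpers1 : ∀ T T', T ≤ T' → T' ≤ T₁ → D T = 1 → D T' = 1 := by
    intro T T' hTT'
    induction T', hTT' using Nat.le_induction with
    | base => exact fun _ h => h
    | succ T' _ ih => exact fun hT h => (hstep1 T' hT (ih (by omega) h)).1
  have hpers2 : ∀ T T', T ≤ T' → T' ≤ T₁ → D T = -1 → D T' = -1 := by
    intro T T' hTT'
    induction T', hTT' using Nat.le_induction with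
    | base => exact fun _ h => h
    | succ T' _ ih => exact fun hT h => (hstep2 T' hT (ih (by omega) h)).1
  have hcases : ∀ T ≤ T₁, D T = 0 ∨ D T = 1 ∨ D T = -1 := by
    intro T hT
    have := abs_le.1 (hle T hT)
    omega
  rcases hcases Tm hm with h | h | h
  · left
    have hzero : ∀ T ≤ Tm, D T = 0 := by
      intro T hT
      rcases hcases T (by omega) with h' | h' | h'
      · exact h'
      · have := hpers1 T Tm hT hm h'; omega
      · have := hpers2 T Tm hT hm h'; omega
    intro T hT
    have := hD T
    rw [hzero T hT.le, hzero (T + 1) hT] at this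
    omega
  · right
    intro T hT hT1
    rw [(hstep1 T hT1 (hpers1 Tm T hT hT1.le h)).2, (hstep1 Tm (by omega) h).2]
  · right
    intro T hT hT1
    rw [(hstep2 T hT1 (hpers2 Tm T hT hT1.le h)).2, (hstep2 Tm (by omega) h).2]

theorem periodic_or_const_of_near_int {β : ℕ} (hβ : 2 ≤ β) (b : ℕ → Fin β) {u s T₁ Tm : ℕ}
    {P : ℤ} (h : |(β : ℝ) ^ u * ((β : ℝ) ^ s - 1) * Real.ofDigits b - P| < ((β : ℝ) ^ T₁)⁻¹)
    (hm : Tm ≤ T₁) :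
    (∀ T < Tm, b (u + T + s) = b (u + T)) ∨
      ∀ T, Tm ≤ T → T < T₁ → b (u + T) = b (u + Tm) := by
  have hβ0 : (0 : ℝ) < β := by positivity
  have hβ1 : (1 : ℝ) ≤ β := by exact_mod_cast (by omega : 1 ≤ β)
  have key := periodic_or_const_of_carry (β := β) (b := fun T => ((b (u + T) : ℕ) : ℤ))
    (D := fun T => (β : ℤ) ^ T * P - digitsPrefix b (u + T + s) + digitsPrefix b (u + T))
    (s := s) (T₁ := T₁) (Tm := Tm) (fun T => by positivity)
    (fun T => by exact_mod_cast (b (u + T)).2) ?_ ?_ hm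
  · refine key.imp (fun hk T hT => ?_) fun hk T hT hT1 => ?_
    · have := hk T hT
      rw [← add_assoc] at this
      exact Fin.ext (by exact_mod_cast this)
    · exact Fin.ext (by exact_mod_cast hk T hT hT1)
  · intro T
    have h1 : digitsPrefix b (u + (T + 1) + s) =
        β * digitsPrefix b (u + T + s) + (b (u + (T + s)) : ℕ) := by
      rw [show u + (T + 1) + s = u + T + s + 1 by omega, digitsPrefix, add_assoc u T s]
    have h2 : digitsPrefix b (u + (T + 1)) = β * digitsPrefix b (u + T) + (b (u + T) : ℕ) := rfl
    simp only [h1, h2]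
    ring
  · intro T hT
    have hp1 := pow_mul_ofDigits hβ b (u + T)
    have hp2 := pow_mul_ofDigits hβ b (u + T + s)
    have h01 := Real.ofDigits_nonneg fun i => b (i + (u + T))
    have h02 := Real.ofDigits_nonneg fun i => b (i + (u + T + s))
    have h11 := Real.ofDigits_le_one fun i => b (i + (u + T))
    have h12 := Real.ofDigits_le_one fun i => b (i + (u + T + s))
    have hsmall : |(β : ℝ) ^ T * ((β : ℝ) ^ u * ((β : ℝ) ^ s - 1) * Real.ofDigits b - P)| < 1 := by
      rw [abs_mul, abs_of_pos (by positivity)]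
      calc _ < (β : ℝ) ^ T * ((β : ℝ) ^ T₁)⁻¹ := by gcongr
        _ ≤ (β : ℝ) ^ T₁ * ((β : ℝ) ^ T₁)⁻¹ := by gcongr
        _ = 1 := mul_inv_cancel₀ (by positivity)
    have hD : ((((β : ℤ) ^ T * P - digitsPrefix b (u + T + s) + digitsPrefix b (u + T) : ℤ)) : ℝ) =
        -((β : ℝ) ^ T * ((β : ℝ) ^ u * ((β : ℝ) ^ s - 1) * Real.ofDigits b - P)) +
          ((Real.ofDigits fun i => b (i + (u + T + s))) -
            Real.ofDigits fun i => b (i + (u + T))) := by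
      rw [pow_add, pow_add] at hp2
      rw [pow_add] at hp1
      push_cast
      linear_combination hp2 - hp1
    obtain ⟨hs1, hs2⟩ := abs_lt.1 hsmall
    -- the carry is an integer of absolute value less than `2`
    have hlt : (((β : ℤ) ^ T * P - digitsPrefix b (u + T + s) + digitsPrefix b (u + T) : ℤ) : ℝ) < 2
        := by rw [hD]; linarith
    have hgt : (-2 : ℝ) <
        (((β : ℤ) ^ T * P - digitsPrefix b (u + T + s) + digitsPrefix b (u + T) : ℤ) : ℝ) := by
      rw [hD]; linarith
    have hlt' := (by exact_mod_cast hlt :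
      (β : ℤ) ^ T * P - digitsPrefix b (u + T + s) + digitsPrefix b (u + T) < 2)
    have hgt' := (by exact_mod_cast hgt :
      -2 < (β : ℤ) ^ T * P - digitsPrefix b (u + T + s) + digitsPrefix b (u + T))
    exact abs_le.2 ⟨by omega, by omega⟩

/-! ### Approximations at every scale and the irrationality exponent -/

/-- If at every scale `k ^ n` there is a multiplier `Q`, of size at most a fixed power of
`β ^ k ^ n`, for which the distance from `Q * x` to the integers lies between two negative powers
of `β ^ k ^ n`, then `x` has no rational approximations of arbitrarily high order. -/
theorem exists_inv_pow_le_abs_sub {x : ℝ} {β k S C n₁ : ℕ} (hβ : 2 ≤ β) (hk : 2 ≤ k)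
    (h : ∀ n, n₁ ≤ n → ∃ Q : ℕ, 0 < Q ∧ Q ≤ β ^ (S * k ^ n) ∧
      (∃ P : ℤ, |Q * x - P| ≤ ((β : ℝ) ^ k ^ n)⁻¹) ∧
      ∀ P : ℤ, ((β : ℝ) ^ (C * k ^ n))⁻¹ ≤ |Q * x - P|) :
    ∃ M Q₀ : ℕ, ∀ q : ℕ, Q₀ ≤ q → ∀ p : ℤ, ((q : ℝ) ^ M)⁻¹ ≤ |x - p / q| := by
  have hβ1 : (1 : ℝ) ≤ β := by exact_mod_cast (by omega : 1 ≤ β)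
  have hβ2 : (2 : ℝ) ≤ β := by exact_mod_cast hβ
  refine ⟨2 * k * (C + S + 1) + 1, β ^ k ^ n₁, fun q hq p => ?_⟩
  have hq2 : 2 ≤ q := hβ.trans ((Nat.le_self_pow (by positivity) β).trans hq)
  have hqR : (0 : ℝ) < q := by positivity
  -- the first scale at which `β ^ k ^ n` exceeds `2 * q`
  have hex : ∃ n, 2 * q < β ^ k ^ n := ⟨2 * q, (Nat.lt_pow_self (by omega : 1 < k)).trans
    (Nat.lt_pow_self (by omega : 1 < β))⟩
  obtain ⟨n, hn, hmin⟩ : ∃ n, 2 * q < β ^ k ^ n ∧ ∀ m < n, ¬ 2 * q < β ^ k ^ m :=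
    ⟨Nat.find hex, Nat.find_spec hex, fun m hm => Nat.find_min hex hm⟩
  have hn1 : n₁ < n := by
    by_contra hcon
    have : β ^ k ^ n ≤ β ^ k ^ n₁ :=
      Nat.pow_le_pow_right (by omega) (Nat.pow_le_pow_right (by omega) (not_lt.1 hcon))
    omega
  obtain ⟨m, rfl⟩ : ∃ m, n = m + 1 := ⟨n - 1, by omega⟩
  have hBle : β ^ k ^ (m + 1) ≤ q ^ (2 * k) := by
    rw [pow_succ, pow_mul, pow_mul]
    refine Nat.pow_le_pow_left ((not_lt.1 (hmin m (by omega))).trans ?_) k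
    nlinarith
  obtain ⟨Q, hQ, hQle, ⟨P, hP⟩, hlow⟩ := h (m + 1) (by omega)
  set K := k ^ (m + 1) with hK
  have hQR : (0 : ℝ) < Q := by positivity
  have hQleR : (Q : ℝ) ≤ (β : ℝ) ^ (S * K) := by exact_mod_cast hQle
  have hnR : 2 * (q : ℝ) < (β : ℝ) ^ K := by exact_mod_cast hn
  have hBleR : (β : ℝ) ^ K ≤ (q : ℝ) ^ (2 * k) := by exact_mod_cast hBle
  have hmain : ((β : ℝ) ^ ((C + S + 1) * K))⁻¹ ≤ |q * x - p| := by
    have hQmul : ((β : ℝ) ^ ((C + 1) * K))⁻¹ ≤ Q * |q * x - p| := by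
      by_cases heq : P * q = p * Q
      · have heqR : (P : ℝ) * q = p * Q := by exact_mod_cast heq
        have : Q * |q * x - p| = q * |Q * x - P| := by
          rw [← abs_of_pos hQR, ← abs_of_pos hqR, ← abs_mul, ← abs_mul, abs_of_pos hQR,
            abs_of_pos hqR]
          congr 1
          linear_combination heqR
        rw [this]
        calc ((β : ℝ) ^ ((C + 1) * K))⁻¹ ≤ ((β : ℝ) ^ (C * K))⁻¹ := by
              gcongr
              exact Nat.le_succ C
          _ ≤ |Q * x - P| := hlow P
          _ ≤ q * |Q * x - P| := le_mul_of_one_le_left (abs_nonneg _)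
              (by exact_mod_cast (by omega : 1 ≤ q))
      · have h1 : (1 : ℝ) ≤ |(P : ℝ) * q - p * Q| := by
          exact_mod_cast Int.one_le_abs (sub_ne_zero.2 heq)
        have h2 : |(P : ℝ) * q - p * Q| ≤ Q * |q * x - p| + q * |Q * x - P| := by
          rw [← abs_of_pos hQR, ← abs_of_pos hqR, ← abs_mul, ← abs_mul, abs_of_pos hQR,
            abs_of_pos hqR]
          calc _ = |(Q : ℝ) * (q * x - p) - q * (Q * x - P)| := by congr 1; ring
            _ ≤ _ := abs_sub _ _
        have h3 : q * |Q * x - P| ≤ 1 / 2 := by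
          calc q * |Q * x - P| ≤ q * ((β : ℝ) ^ K)⁻¹ := by gcongr
            _ ≤ 1 / 2 := by
              rw [← div_eq_mul_inv, div_le_iff₀ (by positivity)]
              linarith
        have h4 : ((β : ℝ) ^ ((C + 1) * K))⁻¹ ≤ 1 / 2 := by
          rw [one_div]
          gcongr
          calc (2 : ℝ) ≤ β := hβ2
            _ ≤ _ := le_self_pow₀ hβ1 (by positivity)
        linarith
    have hS : (β : ℝ) ^ ((C + S + 1) * K) = (β : ℝ) ^ ((C + 1) * K) * (β : ℝ) ^ (S * K) := by
      rw [← pow_add]; ring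
    rw [hS, mul_inv, ← div_eq_mul_inv, div_le_iff₀ (by positivity)]
    calc _ ≤ Q * |q * x - p| := hQmul
      _ ≤ (β : ℝ) ^ (S * K) * |q * x - p| := by gcongr
      _ = _ := mul_comm _ _
  have hxq : |x - p / q| = |q * x - p| / q := by
    rw [← abs_of_pos hqR, ← abs_div, abs_of_pos hqR]
    congr 1
    field_simp
  rw [hxq, le_div_iff₀ hqR, pow_succ, mul_inv, mul_assoc, inv_mul_cancel₀ hqR.ne', mul_one]
  refine le_trans ?_ hmain
  gcongr
  rw [mul_comm _ K, pow_mul, pow_mul]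
  gcongr

theorem irrational_of_inv_pow_le {x : ℝ} {M Q₀ : ℕ}
    (h : ∀ q : ℕ, Q₀ ≤ q → ∀ p : ℤ, ((q : ℝ) ^ M)⁻¹ ≤ |x - p / q|) : Irrational x := by
  rintro ⟨r, rfl⟩
  -- the denominator may be expanded beyond `Q₀`
  have h1 := h (r.den * (Q₀ + 1))
    ((Nat.le_succ _).trans (Nat.le_mul_of_pos_left _ r.den_pos)) (r.num * (Q₀ + 1))
  have h2 : (r : ℝ) - ((r.num * (Q₀ + 1) : ℤ) : ℝ) / ((r.den * (Q₀ + 1) : ℕ) : ℝ) = 0 := by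
    push_cast
    rw [mul_div_mul_right _ _ (by positivity), sub_eq_zero]
    exact Rat.cast_def r
  rw [h2, abs_zero] at h1
  have : (0 : ℝ) < r.den := by exact_mod_cast r.den_pos
  exact absurd h1 (not_le.2 (by positivity))

theorem irrationalityExponent_eq_coe {x : ℝ} (hx0 : 0 < x) (hx1 : x < 1) {M Q₀ : ℕ}
    (h : ∀ q : ℕ, Q₀ ≤ q → ∀ p : ℤ, ((q : ℝ) ^ M)⁻¹ ≤ |x - p / q|) :
    ∃ m : ℝ, irrationalityExponent x = (m : EReal) := by
  have hle : irrationalityExponent x ≤ ((M : ℝ) : EReal) := by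
    refine sSup_le ?_
    rintro _ ⟨μ, hμ, rfl⟩
    refine EReal.coe_le_coe_iff.2 (not_lt.1 fun hlt => hμ ?_)
    have hbig : ∀ y : ℤ × ℤ, y.2 ≠ 0 → (1 : ℝ) ≤ |(y.2 : ℝ)| := fun y hy => by
      exact_mod_cast Int.one_le_abs hy
    -- the denominators are below `Q₀`, and the numerators are bounded along with them
    refine ((Set.finite_Icc (-(2 * Q₀ : ℤ)) (2 * Q₀)).prod
      (Set.finite_Icc (-(Q₀ : ℤ)) Q₀)).subset ?_
    rintro ⟨p, q⟩ ⟨-, hq0, hpq⟩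
    have hq1 := hbig (p, q) hq0
    simp only at hq0 hpq hq1
    have hqpos : (0 : ℝ) < |(q : ℝ)| := by linarith
    have hqQ : |q| < Q₀ := by
      by_contra hcon
      have hcast : ((q.natAbs : ℕ) : ℝ) = |(q : ℝ)| := by
        rw [Nat.cast_natAbs, Int.cast_abs]
      have h1 := h q.natAbs (by zify; exact not_lt.1 hcon) (p * q.sign)
      have h2 : ((p * q.sign : ℤ) : ℝ) / ((q.natAbs : ℕ) : ℝ) = p / q := by
        rw [hcast]
        have hqR : (q : ℝ) ≠ 0 := by exact_mod_cast hq0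
        rcases lt_or_gt_of_ne hq0 with hneg | hpos
        · rw [Int.sign_eq_neg_one_of_neg hneg, abs_of_neg (by exact_mod_cast hneg)]
          push_cast
          rw [mul_neg_one, neg_div_neg_eq]
        · rw [Int.sign_eq_one_of_pos hpos, abs_of_pos (by exact_mod_cast hpos)]
          simp
      rw [h2, hcast] at h1
      have h3 : 1 / |(q : ℝ)| ^ μ ≤ (|(q : ℝ)| ^ M)⁻¹ := by
        rw [one_div, ← Real.rpow_natCast]
        gcongr
      linarith
    have hpR : |(p : ℝ)| < 2 * |(q : ℝ)| := by
      have hμ0 : (0 : ℝ) ≤ μ := (Nat.cast_nonneg M).trans hlt.le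
      have h1 : 1 / |(q : ℝ)| ^ μ ≤ 1 := by
        rw [div_le_one (by positivity)]
        exact Real.one_le_rpow hq1 hμ0
      have h2 : |(p : ℝ) / q| < 2 := by
        have := abs_lt.1 (hpq.trans_le h1)
        rw [abs_lt]
        constructor <;> linarith
      rwa [abs_div, div_lt_iff₀ hqpos] at h2
    have hpZ : |p| < 2 * |q| := by exact_mod_cast hpR
    have hp' := abs_le.1 (show |p| ≤ 2 * Q₀ by omega)
    have hq' := abs_le.1 hqQ.le
    exact ⟨⟨hp'.1, hp'.2⟩, ⟨hq'.1, hq'.2⟩⟩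
  -- for the exponent `0` the fractions `1 / q` are solutions
  have hge : ((0 : ℝ) : EReal) ≤ irrationalityExponent x := by
    refine le_sSup ⟨0, ?_, rfl⟩
    refine Set.infinite_of_injective_forall_mem (f := fun i : ℕ => ((1 : ℤ), (i : ℤ) + 1))
      (fun i j hij => by simpa using hij) fun i => ⟨one_ne_zero, by positivity, ?_⟩
    have h1 : (0 : ℝ) < 1 / ((i : ℝ) + 1) := by positivity
    have h2 : 1 / ((i : ℝ) + 1) ≤ 1 := by
      rw [div_le_one (by positivity)]
      linarith [show (0 : ℝ) ≤ i by positivity]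
    push_cast
    rw [Real.rpow_zero, div_one, abs_lt]
    constructor <;> linarith
  induction hE : irrationalityExponent x with
  | bot => rw [hE] at hge; simp at hge
  | top => rw [hE] at hle; exact absurd (top_le_iff.1 hle) (EReal.coe_ne_top _)
  | coe m => exact ⟨m, rfl⟩


/-! ### Repetition and failure of periodicity in blocks of length `k ^ n` -/

theorem tailIndex_add_mul_period {L k : ℕ} (hk : 2 ≤ k) {κ : ℕ → ℕ → Fin L} {N₀ t : ℕ}
    (hper : ∀ s, 1 ≤ s → s ≤ k - 1 → ∀ n, N₀ ≤ n → κ s n = κ s (n + t)) {n : ℕ} (hn : N₀ ≤ n)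
    (i m : ℕ) : tailIndex L k κ (n + i * t) m = tailIndex L k κ n m := by
  induction i with
  | zero => simp
  | succ i ih =>
    rw [← ih]
    refine digitSum_congr hk (fun s hs y => ?_) m
    rcases Nat.eq_zero_or_pos s with rfl | hs0
    · simp [weight_zero]
    · rw [weight, weight, if_neg hs0.ne', if_neg hs0.ne',
        show n + (i + 1) * t + y = n + i * t + y + t by ring,
        ← hper s hs0 (by omega) _ (by omega)]

/-- The functions `m ↦ tailIndex L k κ n m` are not ultimately periodic along the multiples of
`l`.  There are only finitely many of them for `n ≥ N₀`, so the place where a given period fails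
can be bounded independently of `n`. -/
theorem exists_uniform_aperiodicity {L k : ℕ} (hk : 2 ≤ k) {κ : ℕ → ℕ → Fin L} {N₀ t : ℕ}
    (ht : 0 < t) (hper : ∀ s, 1 ≤ s → s ≤ k - 1 → ∀ n, N₀ ≤ n → κ s n = κ s (n + t))
    (hnp : ¬ PeriodicityCondition L k κ) {l : ℕ} (hl : 0 < l) (S : ℕ) :
    ∃ G : ℕ → ℕ, ∀ n, N₀ ≤ n → ∀ s, 0 < s → s ≤ S → ∀ J, ∃ j, J ≤ j ∧ j < G J ∧
      tailIndex L k κ n (j * l) ≠ tailIndex L k κ n ((j + s) * l) := by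
  have hex : ∀ n s J, ∃ j, 0 < s → J ≤ j ∧
      tailIndex L k κ n (j * l) ≠ tailIndex L k κ n ((j + s) * l) := by
    intro n s J
    by_cases hs : 0 < s
    · by_contra! hcon
      refine hnp (periodicityCondition_of_const hk κ n (N := J * l) (l := s * l) (by positivity)
        fun i => ?_)
      induction i with
      | zero => simp
      | succ i ih =>
        rw [← ih, show J * l + (i + 1) * (s * l) = (J + i * s + s) * l by ring,
          ← (hcon (J + i * s)).2 (by omega)]
        congr 1
        ring
    · exact ⟨0, fun h => absurd h hs⟩
  choose g hg using hex
  refine ⟨fun J => (Finset.range t ×ˢ Finset.range (S + 1)).sup (fun x => g (N₀ + x.1) x.2 J) + 1,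
    fun n hn s hs hsS J => ?_⟩
  have hmod : N₀ + (n - N₀) % t + (n - N₀) / t * t = n := by
    rw [add_assoc, Nat.mod_add_div']; omega
  have heq : ∀ m, tailIndex L k κ n m = tailIndex L k κ (N₀ + (n - N₀) % t) m := fun m => by
    conv_lhs => rw [← hmod]
    exact tailIndex_add_mul_period hk hper (Nat.le_add_right _ _) _ m
  obtain ⟨h1, h2⟩ := hg (N₀ + (n - N₀) % t) s J hs
  refine ⟨_, h1, Nat.lt_succ_of_le ?_, by rwa [heq, heq]⟩
  exact Finset.le_sup (f := fun x : ℕ × ℕ => g (N₀ + x.1) x.2 J) (b := ((n - N₀) % t, s))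
    (by simpa using ⟨Nat.mod_lt _ ht, by omega⟩)

/-- Two of the first `L ^ (l + 1) + 1` blocks of length `k ^ n` along the progression are equal:
a block is determined by the vector of the values of `tailIndex` at `j * l, …, j * l + l`. -/
theorem exists_equal_blocks {L k : ℕ} [NeZero L] (hk : 2 ≤ k) (κ : ℕ → ℕ → Fin L)
    (c : ZMod L → ℂ) {N n : ℕ} (hN : N < k ^ n) (l : ℕ) :
    ∃ j j', j < j' ∧ j' ≤ L ^ (l + 1) ∧ ∀ i < k ^ n,
      seq L k κ c (N + (j * k ^ n + i) * l) = seq L k κ c (N + (j' * k ^ n + i) * l) := by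
  obtain ⟨x, y, hxy, hE⟩ := Fintype.exists_ne_map_eq_of_card_lt
    (fun (x : Fin (L ^ (l + 1) + 1)) (h : Fin (l + 1)) => tailIndex L k κ n (x * l + h))
    (by simp [ZMod.card])
  have hblock : ∀ x y : Fin (L ^ (l + 1) + 1),
      ((fun h : Fin (l + 1) => tailIndex L k κ n (x * l + h)) =
        fun h : Fin (l + 1) => tailIndex L k κ n (y * l + h)) → ∀ i < k ^ n,
      seq L k κ c (N + (x * k ^ n + i) * l) = seq L k κ c (N + (y * k ^ n + i) * l) := by
    intro x y h i hi
    have hK : 0 < k ^ n := by positivity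
    have hh : (N + i * l) / k ^ n < l + 1 := by
      rw [Nat.div_lt_iff_lt_mul hK]
      nlinarith [Nat.mul_le_mul_right l hi.le]
    have hpos : ∀ z : ℕ, N + (z * k ^ n + i) * l =
        (N + i * l) % k ^ n + k ^ n * (z * l + (N + i * l) / k ^ n) := fun z => by
      have := Nat.mod_add_div (N + i * l) (k ^ n)
      linear_combination -this
    rw [hpos, hpos, seq_add_pow_mul hk κ c (Nat.mod_lt _ hK),
      seq_add_pow_mul hk κ c (Nat.mod_lt _ hK)]
    congr 2
    exact congrFun h ⟨_, hh⟩
  rcases lt_or_gt_of_ne hxy with hlt | hlt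
  · exact ⟨x, y, hlt, by omega, hblock x y hE⟩
  · exact ⟨y, x, hlt, by omega, hblock y x hE.symm⟩

/-- At the scale `k ^ n`, two equal blocks at `j` and `j'` give the multiplier
`Q = β ^ (j * k ^ n) * (β ^ ((j' - j) * k ^ n) - 1)`.  An integer too close to `Q * x` would make
the expansion periodic with period `(j' - j) * k ^ n`, or constant, on a long range of blocks,
against the uniform aperiodicity. -/
theorem exists_inv_pow_le_abs_ofDigits_sub {L k β : ℕ} (hL : 2 ≤ L) (hk : 2 ≤ k) (hβ : 2 ≤ β)
    (κ : ℕ → ℕ → Fin L) (c : ZMod L → ℂ) (hc : Function.Injective c)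
    (hper : IsNPeriod L k κ) (hnp : ¬ PeriodicityCondition L k κ) {N l : ℕ} (hl : 0 < l)
    (b : ℕ → Fin β) (hb : ∀ i, ((b i : ℕ) : ℂ) = seq L k κ c (N + i * l)) :
    ∃ M Q₀ : ℕ, ∀ q : ℕ, Q₀ ≤ q → ∀ p : ℤ, ((q : ℝ) ^ M)⁻¹ ≤ |Real.ofDigits b - p / q| := by
  have : NeZero L := ⟨by omega⟩
  obtain ⟨N₀, t, ht, hper⟩ := hper
  have hbeq : ∀ i i', b i = b i' ↔ seq L k κ c (N + i * l) = seq L k κ c (N + i' * l) := by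
    intro i i'
    rw [← hb, ← hb, Nat.cast_inj, Fin.val_inj]
  set S := L ^ (l + 1) with hS
  have hS0 : 0 < S := by positivity
  obtain ⟨G, hG⟩ := exists_uniform_aperiodicity hk ht hper hnp hl S
  refine exists_inv_pow_le_abs_sub (k := k) (S := S) (C := G S + G (G S + S) + 1)
    (n₁ := N₀ + N) hβ hk fun n hn => ?_
  have hN : N < k ^ n :=
    (Nat.lt_pow_self (by omega : 1 < k)).trans_le (Nat.pow_le_pow_right (by omega) (by omega))
  obtain ⟨j, j', hjj', hj'S, hblocks⟩ := exists_equal_blocks hk κ c hN l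
  have hfirst : ∀ i i', b (i * k ^ n) = b (i' * k ^ n) →
      tailIndex L k κ n (i * l) = tailIndex L k κ n (i' * l) := by
    intro i i' h
    rw [hbeq, show N + i * k ^ n * l = N + k ^ n * (i * l) by ring,
      show N + i' * k ^ n * l = N + k ^ n * (i' * l) by ring,
      seq_add_pow_mul hk κ c hN, seq_add_pow_mul hk κ c hN] at h
    exact add_left_cancel (hc h)
  obtain ⟨s, rfl⟩ : ∃ s, j' = j + s := ⟨j' - j, by omega⟩
  set K := k ^ n with hK
  have hK0 : 0 < K := by positivity
  have hpow1 : 1 < β ^ (s * K) := Nat.one_lt_pow (Nat.mul_pos (by omega) hK0).ne' (by omega)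
  have hQcast : ((β ^ (j * K) * (β ^ (s * K) - 1) : ℕ) : ℝ) =
      (β : ℝ) ^ (j * K) * ((β : ℝ) ^ (s * K) - 1) := by
    push_cast [hpow1.le]
    ring
  refine ⟨β ^ (j * K) * (β ^ (s * K) - 1), Nat.mul_pos (by positivity) (by omega), ?_, ?_, ?_⟩
  · calc β ^ (j * K) * (β ^ (s * K) - 1) ≤ β ^ (j * K) * β ^ (s * K) :=
          Nat.mul_le_mul_left _ (Nat.sub_le _ _)
      _ = β ^ ((j + s) * K) := by rw [← pow_add]; ring
      _ ≤ β ^ (S * K) := Nat.pow_le_pow_right (by omega) (Nat.mul_le_mul_right _ hj'S)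
  · rw [hQcast]
    refine exists_abs_mul_ofDigits_sub_le hβ b fun i hi => ?_
    rw [hbeq, ← add_mul]
    exact hblocks i hi
  · intro P
    rw [hQcast]
    by_contra! hcon
    rcases periodic_or_const_of_near_int hβ b hcon (Tm := G S * K)
      (Nat.mul_le_mul_right _ (by omega)) with h | h
    · obtain ⟨i, hSi, hiG, hne⟩ := hG n (by omega) s (by omega) (by omega) S
      obtain ⟨d, rfl⟩ : ∃ d, i = j + d := ⟨i - j, by omega⟩
      refine hne (hfirst _ _ ?_)
      have := h (d * K) (Nat.mul_lt_mul_of_pos_right (by omega) hK0)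
      rw [← add_mul, ← add_mul] at this
      exact this.symm
    · obtain ⟨i, hSi, hiG, hne⟩ := hG n (by omega) 1 one_pos hS0 (G S + S)
      obtain ⟨d, rfl⟩ : ∃ d, i = j + d := ⟨i - j, by omega⟩
      have hconst : ∀ e, G S ≤ e → e < G S + G (G S + S) + 1 →
          b ((j + e) * K) = b (j * K + G S * K) := fun e he1 he2 => by
        rw [add_mul]
        exact h _ (Nat.mul_le_mul_right _ he1) (Nat.mul_lt_mul_of_pos_right he2 hK0)
      exact hne (hfirst _ _ ((hconst d (by omega) (by omega)).trans
        (hconst (d + 1) (by omega) (by omega)).symm))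

end GenThueMorse

theorem theorem5p3 (L k β : ℕ) (hL : 2 ≤ L) (hk : 2 ≤ k) (hβ : 2 ≤ β)
    (κ : ℕ → ℕ → Fin L) (c : ZMod L → ℂ) (hc : Function.Injective c)
    (a : ℕ → ℕ) (ha : ∀ n, (a n : ℂ) = GenThueMorse.seq L k κ c n) (haβ : ∀ n, a n < β)
    (hper : GenThueMorse.IsNPeriod L k κ)
    (hnp : ¬ GenThueMorse.PeriodicityCondition L k κ)
    (N l : ℕ) (hl : 0 < l) :
    Irrational (∑' n : ℕ, (a (N + n * l) : ℝ) / (β : ℝ) ^ (n + 1)) ∧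
      ∃ m : ℝ, GenThueMorse.irrationalityExponent
        (∑' n : ℕ, (a (N + n * l) : ℝ) / (β : ℝ) ^ (n + 1)) = (m : EReal) := by
  set b : ℕ → Fin β := fun i => ⟨a (N + i * l), haβ _⟩ with hb
  have hx : ∑' n : ℕ, (a (N + n * l) : ℝ) / (β : ℝ) ^ (n + 1) = Real.ofDigits b :=
    tsum_congr fun n => by simp [Real.ofDigitsTerm, hb, div_eq_mul_inv]
  rw [hx]
  obtain ⟨M, Q₀, h⟩ := GenThueMorse.exists_inv_pow_le_abs_ofDigits_sub hL hk hβ κ c hc hper hnp hl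
    b fun i => ha _
  have hirr := GenThueMorse.irrational_of_inv_pow_le h
  exact ⟨hirr, GenThueMorse.irrationalityExponent_eq_coe
    ((Real.ofDigits_nonneg b).lt_of_ne hirr.ne_zero.symm)
    ((Real.ofDigits_le_one b).lt_of_ne hirr.ne_one) h⟩
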